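/- Let $X,Y$ be compact metric spaces, $c:X\times Y\to[0,+\infty)$ a continuous function, and $\mu,\nu$ Borel probability measures on $X$ and $Y$ respectively. Let $\Gamma(\mu,\nu)$ be the set of Borel probability measures on $X\times Y$ with marginals $\mu$ and $\nu$, and set $$T_c(\mu,\nu):=\inf\Big\{\int_{X\times Y}c\,d\gamma\ :\ \gamma\in\Gamma(\mu,\nu)\Big\},\qquad \mathcal F_c:=\{(\varphi,\psi)\in C^0(X)\times C^0(Y)\ :\ \varphi(x)+\psi(y)\le c(x,y)\ \ \forall (x,y)\in X\times Y\}.$$ For $\varphi\in C^0(X)$ and $\psi\in C^0(Y)$ write $\varphi^c(y):=\inf_{x\in X}\,(c(x,y)-\varphi(x))$ and $\psi^c(x):=\inf_{y\in Y}\,(c(x,y)-\psi(y))$; a pair $(\varphi,\psi)\in\mathcal F_c$ is called a pair of $c$-concave conjugate functions if $\psi=\varphi^c$ and $\varphi=\psi^c$. Then the infimum defining $T_c(\mu,\nu)$ is attained, and $$T_c(\mu,\nu)=\sup\Big\{\int_X\varphi\,d\mu+\int_Y\psi\,d\nu\ :\ (\varphi,\psi)\in\mathcal F_c\Big\}.$$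 Moreover, the supremum is attained by a pair $(\bar\varphi,\bar\psi)$ of $c$-concave conjugate functions such that, for every $\bar\gamma\in\Gamma(\mu,\nu)$ with $\int c\,d\bar\gamma=T_c(\mu,\nu)$, one has $\bar\varphi(x)+\bar\psi(y)=c(x,y)$ for $\bar\gamma$-almost every $(x,y)$. -/

import Mathlib

open MeasureTheory

noncomputable section

namespace OptimalTransport

/-- The set `Γ(μ, ν)` of transport plans: probability measures on `X × Y` with
marginals `μ` and `ν`. -/
def plans {X Y : Type*} [MeasurableSpace X] [MeasurableSpace Y]
    (μ : ProbabilityMeasure X) (ν : ProbabilityMeasure Y) : Set (ProbabilityMeasure (X × Y)) :=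
  {γ | (γ : Measure (X × Y)).map Prod.fst = (μ : Measure X) ∧
    (γ : Measure (X × Y)).map Prod.snd = (ν : Measure Y)}

/-- The total cost `∫ c(x,y) γ(dxdy)` of a plan. -/
def planCost {X Y : Type*} [MeasurableSpace X] [MeasurableSpace Y]
    (c : X × Y → ℝ) (γ : ProbabilityMeasure (X × Y)) : ℝ :=
  ∫ p, c p ∂(γ : Measure (X × Y))

/-- The Monge–Kantorovich value `T_c(μ, ν)`. -/
def transportCost {X Y : Type*} [MeasurableSpace X] [MeasurableSpace Y]
    (c : X × Y → ℝ) (μ : ProbabilityMeasure X) (ν : ProbabilityMeasure Y) : ℝ :=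
  sInf (planCost c '' plans μ ν)

/-- `γ` is an optimal plan: it belongs to `Γ(μ, ν)` and realizes the infimum. -/
def IsOptimalPlan {X Y : Type*} [MeasurableSpace X] [MeasurableSpace Y]
    (c : X × Y → ℝ) (μ : ProbabilityMeasure X) (ν : ProbabilityMeasure Y)
    (γ : ProbabilityMeasure (X × Y)) : Prop :=
  γ ∈ plans μ ν ∧ planCost c γ = transportCost c μ ν

/-- The class `F_c` of pairs of continuous functions with `φ(x) + ψ(y) ≤ c(x,y)`. -/
def admissiblePairs {X Y : Type*} [TopologicalSpace X] [TopologicalSpace Y]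
    (c : X × Y → ℝ) : Set (C(X, ℝ) × C(Y, ℝ)) :=
  {p | ∀ x y, p.1 x + p.2 y ≤ c (x, y)}

/-- The dual objective `∫ φ dμ + ∫ ψ dν`. -/
def dualValue {X Y : Type*} [TopologicalSpace X] [TopologicalSpace Y]
    [MeasurableSpace X] [MeasurableSpace Y]
    (μ : ProbabilityMeasure X) (ν : ProbabilityMeasure Y) (p : C(X, ℝ) × C(Y, ℝ)) : ℝ :=
  (∫ x, p.1 x ∂(μ : Measure X)) + ∫ y, p.2 y ∂(ν : Measure Y)

/-- The c-transform `φᶜ(y) = inf_x (c(x,y) - φ(x))` of a function on `X`. -/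
def cTransform {X Y : Type*} (c : X × Y → ℝ) (φ : X → ℝ) (y : Y) : ℝ :=
  ⨅ x, (c (x, y) - φ x)

/-- The symmetric c-transform `ψᶜ(x) = inf_y (c(x,y) - ψ(y))` of a function on `Y`. -/
def cTransform' {X Y : Type*} (c : X × Y → ℝ) (ψ : Y → ℝ) (x : X) : ℝ :=
  ⨅ y, (c (x, y) - ψ y)

/-- A pair of c-concave conjugate functions: an element of `F_c` with `ψ = φᶜ` and `φ = ψᶜ`. -/
def IsConjugatePair {X Y : Type*} [TopologicalSpace X] [TopologicalSpace Y]
    (c : X × Y → ℝ) (p : C(X, ℝ) × C(Y, ℝ)) : Prop :=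
  p ∈ admissiblePairs c ∧ (∀ y, p.2 y = cTransform c p.1 y) ∧ (∀ x, p.1 x = cTransform' c p.2 x)

end OptimalTransport

end

open MeasureTheory
open scoped CompactlySupported

namespace OptimalTransport

/-! ### The c-transform and conjugate pairs -/

section CTransform

variable {X Y : Type*} [TopologicalSpace X] [TopologicalSpace Y]

/-! The dual problem is solved by compactness: double c-transformation raises an admissible pair to
a conjugate one, whose components inherit the modulus of continuity of `c`; adding a constant to one
component and subtracting it from the other keeps the value, so Arzelà–Ascoli gives a maximizer.

Strong duality is Hahn–Banach plus Riesz. Let `N f` be the least `dualValue` of a pair with `f ≤ φ ⊕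
ψ`, where `φ ⊕ ψ` is `φ(x) + ψ(y)`. `N` is sublinear, so some linear `Λ ≤ N` has `Λ (-c) = N (-c)`.
Domination makes `Λ` positive and forces `Λ (φ ⊕ ψ) = ∫ φ dμ + ∫ ψ dν`; hence `Λ` is a plan, of cost
`-N (-c)`, the dual value. Equality of the two values then yields the extremality relation. -/

/-- On a compact space, the c-transform of a continuous function is continuous. -/
theorem continuous_cTransform [CompactSpace X] {c : X × Y → ℝ} (hc : Continuous c)
    (φ : C(X, ℝ)) : Continuous (cTransform c φ) := by
  have h : Continuous fun y => sInf ((fun x => c (x, y) - φ x) '' Set.univ) :=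
    isCompact_univ.continuous_sInf (by fun_prop)
  simp only [Set.image_univ] at h
  exact h

/-- The c-transform of a continuous function, as a continuous function. -/
noncomputable def cTransformMap [CompactSpace X] (c : C(X × Y, ℝ)) (φ : C(X, ℝ)) : C(Y, ℝ) :=
  ⟨cTransform c φ, continuous_cTransform c.continuous φ⟩

/-- The cost with the roles of the two spaces exchanged. -/
def swapCost (c : C(X × Y, ℝ)) : C(Y × X, ℝ) := c.comp ⟨Prod.swap, continuous_swap⟩

@[simp]
theorem swapCost_apply (c : C(X × Y, ℝ)) (x : X) (y : Y) : swapCost c (y, x) = c (x, y) := rfl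

/-- The continuous functions vanishing at `x₀` and admitting the modulus of continuity of a
continuous map `F` form a compact set. -/
theorem isCompact_setOf_modulus {E : Type*} [PseudoMetricSpace E] (F : C(X, E)) (x₀ : X) :
    IsCompact {φ : C(X, ℝ) | φ x₀ = 0 ∧ ∀ x x', |φ x - φ x'| ≤ dist (F x) (F x')} := by
  set S := {φ : C(X, ℝ) | φ x₀ = 0 ∧ ∀ x x', |φ x - φ x'| ≤ dist (F x) (F x')} with hS
  have equi : ∀ x, ∀ ε > 0, ∀ᶠ x' in nhds x, dist (F x) (F x') < ε := fun x ε hε => by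
    have h : Filter.Tendsto (fun x' => dist (F x) (F x')) (nhds x) (nhds (dist (F x) (F x))) :=
      (by fun_prop : Continuous fun x' => dist (F x) (F x')).tendsto x
    rw [dist_self] at h
    exact h.eventually (gt_mem_nhds hε)
  refine ArzelaAscoli.isCompact_of_equicontinuous S ?_ ?_
  -- In the product topology the image is a closed subset of a product of balls, since the modulus
  -- alone forces continuity.
  · have him : ContinuousMap.toFun '' S =
        {f : X → ℝ | f x₀ = 0 ∧ ∀ x x', |f x - f x'| ≤ dist (F x) (F x')} := by
      ext f
      constructor
      · rintro ⟨φ, hφ, rfl⟩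
        exact hφ
      · rintro ⟨h0, h⟩
        refine ⟨⟨f, ?_⟩, ⟨h0, h⟩, rfl⟩
        refine continuous_iff_continuousAt.2 fun x => Metric.tendsto_nhds.2 fun ε hε => ?_
        filter_upwards [equi x ε hε] with x' hx'
        rw [dist_comm, Real.dist_eq]
        exact (h x x').trans_lt hx'
    rw [him]
    have hbox : IsCompact (Set.univ.pi fun x => Metric.closedBall (0 : ℝ) (dist (F x) (F x₀))) :=
      isCompact_univ_pi fun x => isCompact_closedBall _ _
    refine hbox.of_isClosed_subset ?_ ?_
    · simp only [Set.ofPred_and, Set.ofPred_forall]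
      refine (isClosed_eq (by fun_prop) (by fun_prop)).inter
        (isClosed_iInter fun x => isClosed_iInter fun x' => isClosed_le (by fun_prop) (by fun_prop))
    · rintro f ⟨h0, h⟩ x -
      simpa [h0] using h x x₀
  · intro x
    refine Metric.equicontinuousAt_iff_right.2 fun ε hε => ?_
    filter_upwards [equi x ε hε] with x' hx' φ
    rw [Real.dist_eq]
    exact (φ.2.2 x x').trans_lt hx'

variable [CompactSpace X]

theorem cTransformMap_le (c : C(X × Y, ℝ)) (φ : C(X, ℝ)) (x : X) (y : Y) :
    cTransformMap c φ y ≤ c (x, y) - φ x :=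
  ciInf_le (isCompact_range (by fun_prop : Continuous fun x => c (x, y) - φ x)).bddBelow x

theorem le_cTransformMap [Nonempty X] {c : C(X × Y, ℝ)} {φ : C(X, ℝ)} {y : Y} {a : ℝ}
    (h : ∀ x, a ≤ c (x, y) - φ x) : a ≤ cTransformMap c φ y :=
  le_ciInf h

/-- The c-transform is nonexpansive for the uniform distance. -/
theorem lipschitzWith_cTransformMap [Nonempty X] [CompactSpace Y] (c : C(X × Y, ℝ)) :
    LipschitzWith 1 (cTransformMap c) := by
  refine LipschitzWith.of_dist_le_mul fun φ φ' => ?_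
  rw [NNReal.coe_one, one_mul, ContinuousMap.dist_le dist_nonneg]
  intro y
  have key : ∀ f g : C(X, ℝ), cTransformMap c f y - dist f g ≤ cTransformMap c g y := by
    refine fun f g => le_cTransformMap fun x => ?_
    have h1 := cTransformMap_le c f x y
    have h2 := (abs_le.1 ((Real.dist_eq _ _).symm.le.trans (ContinuousMap.dist_apply_le_dist
      (f := f) (g := g) x))).1
    linarith
  rw [Real.dist_eq, abs_le]
  have h1 := key φ φ'
  have h2 := key φ' φ
  rw [dist_comm] at h2
  constructor <;> linarith

/-- A c-transform inherits the modulus of continuity of the cost. -/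
theorem cTransformMap_sub_le [Nonempty X] (c : C(X × Y, ℝ)) (φ : C(X, ℝ)) (y y' : Y) :
    |cTransformMap c φ y - cTransformMap c φ y'| ≤
      dist ((swapCost c).curry y) ((swapCost c).curry y') := by
  have key : ∀ z z' : Y, cTransformMap c φ z - dist ((swapCost c).curry z) ((swapCost c).curry z')
      ≤ cTransformMap c φ z' := by
    refine fun z z' => le_cTransformMap fun x => ?_
    have h1 := cTransformMap_le c φ x z
    have h2 : |c (x, z) - c (x, z')| ≤ _ := (Real.dist_eq _ _).symm.le.trans
      (ContinuousMap.dist_apply_le_dist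
        (f := (swapCost c).curry z) (g := (swapCost c).curry z') x)
    linarith [(abs_le.1 h2).2]
  rw [abs_le]
  have h1 := key y y'
  have h2 := key y' y
  rw [dist_comm] at h2
  constructor <;> linarith

/-- Applying the c-transform twice to an admissible pair yields a conjugate pair above it. -/
theorem exists_isConjugatePair_ge [Nonempty X] [CompactSpace Y] [Nonempty Y] {c : C(X × Y, ℝ)}
    {p : C(X, ℝ) × C(Y, ℝ)} (hp : p ∈ admissiblePairs c) :
    ∃ q, IsConjugatePair c q ∧ p ≤ q ∧ q.1 = cTransformMap (swapCost c) p.2 := by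
  set φ := cTransformMap (swapCost c) p.2 with hφ
  have h1 : p.1 ≤ φ := fun x => le_cTransformMap fun y => by
    have := hp x y
    change p.1 x ≤ c (x, y) - p.2 y
    linarith
  have h2 : p.2 ≤ cTransformMap c φ := fun y => le_cTransformMap fun x => by
    have : φ x ≤ c (x, y) - p.2 y := cTransformMap_le (swapCost c) p.2 y x
    change p.2 y ≤ c (x, y) - φ x
    linarith
  refine ⟨(φ, cTransformMap c φ), ⟨fun x y => ?_, fun y => rfl, fun x => ?_⟩, ⟨h1, h2⟩, rfl⟩
  · have := cTransformMap_le c φ x y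
    simp only
    linarith
  · change φ x = cTransformMap (swapCost c) (cTransformMap c φ) x
    refine le_antisymm (le_cTransformMap fun y => ?_) (le_cTransformMap fun y => ?_)
    · have := cTransformMap_le c φ x y
      simp only [swapCost_apply]
      linarith
    -- The c-transform reverses order, and `p.2` lies below the transform of `φ`.
    · have := cTransformMap_le (swapCost c) (cTransformMap c φ) y x
      have h : p.2 y ≤ cTransformMap c φ y := h2 y
      linarith

end CTransform

/-! ### Existence of dual maximizers -/

section Duality

theorem integrable_continuousMap {Z : Type*} [TopologicalSpace Z] [CompactSpace Z]
    [MeasurableSpace Z] [OpensMeasurableSpace Z] (m : Measure Z) [IsFiniteMeasure m]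
    (f : C(Z, ℝ)) : Integrable f m :=
  (BoundedContinuousFunction.mkOfCompact f).integrable m

theorem continuous_integral_continuousMap {Z : Type*} [TopologicalSpace Z] [CompactSpace Z]
    [MeasurableSpace Z] [OpensMeasurableSpace Z] (m : ProbabilityMeasure Z) :
    Continuous fun f : C(Z, ℝ) => ∫ z, f z ∂(m : Measure Z) := by
  refine (LipschitzWith.of_dist_le_mul (K := 1) fun f g => ?_).continuous
  rw [Real.dist_eq, ← integral_sub (integrable_continuousMap _ _) (integrable_continuousMap _ _),
    NNReal.coe_one, one_mul]
  have := norm_integral_le_of_norm_le_const (μ := (m : Measure Z)) (f := fun z => f z - g z)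
    (C := dist f g) (Filter.Eventually.of_forall fun z => by
      rw [← dist_eq_norm]; exact ContinuousMap.dist_apply_le_dist z)
  simpa using this

variable {X Y : Type*} [TopologicalSpace X] [MeasurableSpace X] [TopologicalSpace Y]
  [MeasurableSpace Y] (μ : ProbabilityMeasure X) (ν : ProbabilityMeasure Y)

theorem dualValue_smul (t : ℝ) (p : C(X, ℝ) × C(Y, ℝ)) :
    dualValue μ ν (t • p) = t * dualValue μ ν p := by
  simp only [dualValue, Prod.smul_fst, Prod.smul_snd, ContinuousMap.smul_apply, smul_eq_mul,
    integral_const_mul]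
  ring

theorem dualValue_const (a b : ℝ) :
    dualValue μ ν (ContinuousMap.const X a, ContinuousMap.const Y b) = a + b := by
  simp [dualValue]

variable [CompactSpace X] [OpensMeasurableSpace X] [CompactSpace Y] [OpensMeasurableSpace Y]

theorem dualValue_add (p q : C(X, ℝ) × C(Y, ℝ)) :
    dualValue μ ν (p + q) = dualValue μ ν p + dualValue μ ν q := by
  simp only [dualValue, Prod.fst_add, Prod.snd_add, ContinuousMap.add_apply]
  rw [integral_add (integrable_continuousMap _ _) (integrable_continuousMap _ _),
    integral_add (integrable_continuousMap _ _) (integrable_continuousMap _ _)]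
  ring

theorem dualValue_mono {p q : C(X, ℝ) × C(Y, ℝ)} (h : p ≤ q) :
    dualValue μ ν p ≤ dualValue μ ν q :=
  add_le_add
    (integral_mono (integrable_continuousMap _ _) (integrable_continuousMap _ _) fun x => h.1 x)
    (integral_mono (integrable_continuousMap _ _) (integrable_continuousMap _ _) fun y => h.2 y)

theorem continuous_dualValue : Continuous (dualValue μ ν) :=
  ((continuous_integral_continuousMap μ).comp continuous_fst).add
    ((continuous_integral_continuousMap ν).comp continuous_snd)

/-- The dual problem has a solution which is a conjugate pair. -/
theorem exists_isConjugatePair_forall_dualValue_le (c : C(X × Y, ℝ)) :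
    ∃ p, IsConjugatePair c p ∧ ∀ q ∈ admissiblePairs c, dualValue μ ν q ≤ dualValue μ ν p := by
  have : Nonempty X := μ.nonempty
  have : Nonempty Y := ν.nonempty
  let x₀ : X := Classical.arbitrary X
  -- For fixed `φ` the best partner is its c-transform, so only `φ` varies.
  obtain ⟨φ, -, hmax⟩ := (isCompact_setOf_modulus c.curry x₀).exists_isMaxOn ⟨0, by simp⟩
    (f := fun φ => dualValue μ ν (φ, cTransformMap c φ))
    ((continuous_dualValue μ ν).comp
      (continuous_id.prodMk (lipschitzWith_cTransformMap c).continuous)).continuousOn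
  have hadm : (φ, cTransformMap c φ) ∈ admissiblePairs c := fun x y => by
    have := cTransformMap_le c φ x y
    simp only
    linarith
  obtain ⟨p, hp, hle, -⟩ := exists_isConjugatePair_ge hadm
  refine ⟨p, hp, fun q hq => le_trans ?_ (dualValue_mono μ ν hle)⟩
  obtain ⟨r, hr, hqr, hr1⟩ := exists_isConjugatePair_ge hq
  refine (dualValue_mono μ ν hqr).trans ?_
  -- Normalize at `x₀`; the constant removed here is returned to the second component in `hle'`.
  set φ' : C(X, ℝ) := r.1 + ContinuousMap.const X (-(r.1 x₀)) with hφ'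
  have hmem : φ' x₀ = 0 ∧ ∀ x x', |φ' x - φ' x'| ≤ dist (c.curry x) (c.curry x') := by
    refine ⟨by simp [hφ'], fun x x' => ?_⟩
    have : _ ≤ dist (c.curry x) (c.curry x') := cTransformMap_sub_le (swapCost c) q.2 x x'
    rw [← hr1] at this
    simpa [hφ'] using this
  refine le_trans ?_ (hmax hmem)
  have hle' : r + (ContinuousMap.const X (-(r.1 x₀)), ContinuousMap.const Y (r.1 x₀)) ≤
      (φ', cTransformMap c φ') := by
    refine ⟨le_rfl, fun y => le_cTransformMap fun x => ?_⟩
    have := hr.1 x y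
    change r.2 y + r.1 x₀ ≤ c (x, y) - (r.1 x + -(r.1 x₀))
    linarith
  have := dualValue_mono μ ν hle'
  rw [dualValue_add, dualValue_const] at this
  linarith

end Duality

/-- On a compact space, a positive normalized linear functional on the continuous functions is
the integral against a probability measure. -/
theorem exists_probabilityMeasure_integral_eq {Z : Type*} [TopologicalSpace Z] [T2Space Z]
    [CompactSpace Z] [MeasurableSpace Z] [BorelSpace Z] (Λ : C(Z, ℝ) →ₗ[ℝ] ℝ)
    (hpos : ∀ f, 0 ≤ f → 0 ≤ Λ f) (hone : Λ 1 = 1) :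
    ∃ γ : ProbabilityMeasure Z, ∀ f : C(Z, ℝ), ∫ z, f z ∂(γ : Measure Z) = Λ f := by
  let L : C_c(Z, ℝ) →ₗ[ℝ] ℝ :=
    { toFun := fun f => Λ f.toContinuousMap
      map_add' := fun f g => Λ.map_add f.toContinuousMap g.toContinuousMap
      map_smul' := fun t f => Λ.map_smul t f.toContinuousMap }
  let P : C_c(Z, ℝ) →ₚ[ℝ] ℝ := PositiveLinearMap.mk₀ L fun f hf => hpos _ hf
  have key : ∀ f : C(Z, ℝ), ∫ z, f z ∂(RealRMK.rieszMeasure P) = Λ f := fun f =>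
    RealRMK.integral_rieszMeasure P (CompactlySupportedContinuousMap.continuousMapEquiv f)
  have h1 := key 1
  simp only [ContinuousMap.one_apply, integral_const, smul_eq_mul, mul_one, hone] at h1
  refine ⟨⟨RealRMK.rieszMeasure P, ⟨?_⟩⟩, key⟩
  rwa [Measure.real, ENNReal.toReal_eq_one_iff] at h1

/-! ### Weak and strong duality -/

section Metric

variable {X Y : Type*}
  [MetricSpace X] [CompactSpace X] [MeasurableSpace X] [BorelSpace X]
  [MetricSpace Y] [CompactSpace Y] [MeasurableSpace Y] [BorelSpace Y]
  {μ : ProbabilityMeasure X} {ν : ProbabilityMeasure Y}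

theorem integral_fst_add_snd {γ : ProbabilityMeasure (X × Y)} (hγ : γ ∈ plans μ ν)
    (p : C(X, ℝ) × C(Y, ℝ)) :
    ∫ z, (p.1 z.1 + p.2 z.2) ∂(γ : Measure (X × Y)) = dualValue μ ν p := by
  have h : ∫ z, (p.1 z.1 + p.2 z.2) ∂(γ : Measure (X × Y)) =
      (∫ z, p.1 z.1 ∂(γ : Measure (X × Y))) + ∫ z, p.2 z.2 ∂(γ : Measure (X × Y)) :=
    integral_add (integrable_continuousMap _ (p.1.comp ContinuousMap.fst))
      (integrable_continuousMap _ (p.2.comp ContinuousMap.snd))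
  rw [h, dualValue, ← hγ.1, ← hγ.2,
    integral_map measurable_fst.aemeasurable p.1.continuous.aestronglyMeasurable,
    integral_map measurable_snd.aemeasurable p.2.continuous.aestronglyMeasurable]

theorem dualValue_le_planCost (c : C(X × Y, ℝ)) {γ : ProbabilityMeasure (X × Y)}
    (hγ : γ ∈ plans μ ν) {p : C(X, ℝ) × C(Y, ℝ)} (hp : p ∈ admissiblePairs c) :
    dualValue μ ν p ≤ planCost c γ := by
  rw [← integral_fst_add_snd hγ p]
  exact integral_mono
    (integrable_continuousMap _ (p.1.comp ContinuousMap.fst + p.2.comp ContinuousMap.snd))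
    (integrable_continuousMap _ c) fun z => hp z.1 z.2

/-- A plan and an admissible pair with equal values satisfy the extremality relation. -/
theorem ae_add_eq_of_dualValue_eq (c : C(X × Y, ℝ)) {γ : ProbabilityMeasure (X × Y)}
    (hγ : γ ∈ plans μ ν) {p : C(X, ℝ) × C(Y, ℝ)} (hp : p ∈ admissiblePairs c)
    (h : dualValue μ ν p = planCost c γ) :
    ∀ᵐ z ∂(γ : Measure (X × Y)), p.1 z.1 + p.2 z.2 = c z := by
  rw [← integral_fst_add_snd hγ p] at h
  exact (integral_eq_iff_of_ae_le
    (integrable_continuousMap _ (p.1.comp ContinuousMap.fst + p.2.comp ContinuousMap.snd))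
    (integrable_continuousMap _ c) (Filter.Eventually.of_forall fun z => hp z.1 z.2)).1 h

/-- Strong duality: some plan costs no more than the value of some admissible pair. -/
theorem exists_plan_planCost_le (μ : ProbabilityMeasure X) (ν : ProbabilityMeasure Y)
    (c : C(X × Y, ℝ)) :
    ∃ γ ∈ plans μ ν, ∃ p ∈ admissiblePairs c, planCost c γ ≤ dualValue μ ν p := by
  -- Dual attainment for the cost `-f`, with signs reversed; no sign condition on the cost is
  -- needed.
  have hmin : ∀ f : C(X × Y, ℝ), ∃ p : C(X, ℝ) × C(Y, ℝ), (∀ x y, f (x, y) ≤ p.1 x + p.2 y) ∧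
      ∀ q : C(X, ℝ) × C(Y, ℝ), (∀ x y, f (x, y) ≤ q.1 x + q.2 y) →
        dualValue μ ν p ≤ dualValue μ ν q := by
    intro f
    obtain ⟨p, hp, hmax⟩ := exists_isConjugatePair_forall_dualValue_le μ ν (-f)
    refine ⟨(-1 : ℝ) • p, fun x y => ?_, fun q hq => ?_⟩
    · have := hp.1 x y
      simp only [ContinuousMap.neg_apply] at this
      simp only [Prod.smul_fst, Prod.smul_snd, ContinuousMap.smul_apply, smul_eq_mul]
      linarith
    · have := hmax ((-1 : ℝ) • q) fun x y => by
        have := hq x y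
        simp only [Prod.smul_fst, Prod.smul_snd, ContinuousMap.smul_apply, smul_eq_mul,
          ContinuousMap.neg_apply]
        linarith
      rw [dualValue_smul] at this ⊢
      linarith
  choose P hP hPmin using hmin
  let N : C(X × Y, ℝ) → ℝ := fun f => dualValue μ ν (P f)
  have N_add : ∀ f g, N (f + g) ≤ N f + N g := fun f g => by
    rw [← dualValue_add]
    refine hPmin _ _ fun x y => ?_
    have h1 := hP f x y
    have h2 := hP g x y
    simp only [Prod.fst_add, Prod.snd_add, ContinuousMap.add_apply]
    linarith
  have N_hom_le : ∀ t : ℝ, 0 < t → ∀ f, N (t • f) ≤ t * N f := fun t ht f => by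
    rw [← dualValue_smul]
    refine hPmin _ _ fun x y => ?_
    simp only [Prod.smul_fst, Prod.smul_snd, ContinuousMap.smul_apply, smul_eq_mul, ← mul_add]
    exact mul_le_mul_of_nonneg_left (hP f x y) ht.le
  have N_hom : ∀ t : ℝ, 0 < t → ∀ f, N (t • f) = t * N f := fun t ht f => by
    refine (N_hom_le t ht f).antisymm ?_
    have h := N_hom_le t⁻¹ (inv_pos.2 ht) (t • f)
    rw [inv_smul_smul₀ ht.ne'] at h
    calc t * N f ≤ t * (t⁻¹ * N (t • f)) := mul_le_mul_of_nonneg_left h ht.le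
      _ = N (t • f) := mul_inv_cancel_left₀ ht.ne' _
  have N_zero : N 0 = 0 := by
    have := N_hom 2 two_pos 0
    rw [smul_zero] at this
    linarith
  let F : C(X × Y, ℝ) →ₗ.[ℝ] ℝ := LinearPMap.mkSpanSingleton' (-c) (N (-c)) fun t ht => by
    rcases smul_eq_zero.1 ht with h | h
    · simp [h]
    · simp [h, N_zero]
  obtain ⟨Λ, hΛF, hΛ⟩ := exists_extension_of_le_sublinear F N N_hom N_add (by
    rintro ⟨f, hf⟩
    obtain ⟨t, rfl⟩ := Submodule.mem_span_singleton.1 hf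
    simp only [F, LinearPMap.mkSpanSingleton'_apply, RingHom.id_apply, smul_eq_mul]
    rcases lt_trichotomy t 0 with ht | rfl | ht
    -- Subadditivity on two opposite vectors: `0 = N 0 ≤ N (t • -c) - t * N (-c)`.
    · have h1 := N_hom (-t) (neg_pos.2 ht) (-c)
      have h2 := N_add (t • -c) (-t • -c)
      rw [← add_smul, add_neg_cancel, zero_smul, N_zero, h1] at h2
      linarith
    · simp [N_zero]
    · exact (N_hom t ht _).ge)
  have hΛc : Λ (-c) = N (-c) := by
    have hmem : -c ∈ F.domain := Submodule.mem_span_singleton_self _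
    rw [hΛF ⟨-c, hmem⟩]
    exact LinearPMap.mkSpanSingleton'_apply_self _ _ _ _
  have hΛ_le : ∀ q : C(X, ℝ) × C(Y, ℝ), Λ (q.1.comp ContinuousMap.fst + q.2.comp ContinuousMap.snd)
      ≤ dualValue μ ν q := fun q => (hΛ _).trans (hPmin _ _ fun x y => le_rfl)
  have hΛ_eq : ∀ q : C(X, ℝ) × C(Y, ℝ),
      Λ (q.1.comp ContinuousMap.fst + q.2.comp ContinuousMap.snd) = dualValue μ ν q := fun q => by
    -- Both sides are linear in `q`, so the inequality at `-q` is the reverse one.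
    refine (hΛ_le q).antisymm ?_
    have h := hΛ_le ((-1 : ℝ) • q)
    have heq : ((-1 : ℝ) • q).1.comp ContinuousMap.fst + ((-1 : ℝ) • q).2.comp ContinuousMap.snd
        = (-1 : ℝ) • (q.1.comp ContinuousMap.fst + q.2.comp ContinuousMap.snd :
          C(X × Y, ℝ)) := by
      ext z
      simp only [Prod.smul_fst, Prod.smul_snd, ContinuousMap.add_apply, ContinuousMap.comp_apply,
        ContinuousMap.smul_apply, smul_add]
    rw [heq, map_smul, dualValue_smul, smul_eq_mul] at h
    linarith
  obtain ⟨γ, hγ⟩ := exists_probabilityMeasure_integral_eq Λ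
    (fun f hf => by
      -- The zero pair dominates `-f`, so `Λ (-f) ≤ N (-f) ≤ 0`.
      have h1 : N (-f) ≤ dualValue μ ν 0 := hPmin _ _ fun x y => by
        have : 0 ≤ f (x, y) := hf (x, y)
        simpa using this
      have h2 := hΛ (-f)
      have h3 : dualValue μ ν 0 = 0 := by simpa using dualValue_smul μ ν 0 0
      rw [map_neg] at h2
      linarith)
    (by
      have h := hΛ_eq (ContinuousMap.const X 1, ContinuousMap.const Y 0)
      rw [dualValue_const, add_zero] at h
      rw [← h]
      congr 1
      ext z
      simp)
  have hγ' : ∀ q : C(X, ℝ) × C(Y, ℝ),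
      ∫ z, (q.1 z.1 + q.2 z.2) ∂(γ : Measure (X × Y)) = dualValue μ ν q := fun q => by
    rw [← hΛ_eq q, ← hγ]
    rfl
  -- The marginals are read off by testing against pairs with one zero component; the cost is `Λ c =
  -- -N (-c)`, the value of `-P (-c)`.
  refine ⟨γ, ⟨?_, ?_⟩, (-1 : ℝ) • P (-c), fun x y => ?_, ?_⟩
  · have := Measure.isProbabilityMeasure_map (μ := (γ : Measure (X × Y)))
      (measurable_fst (α := X) (β := Y)).aemeasurable
    refine ext_of_forall_integral_eq_of_IsFiniteMeasure fun f => ?_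
    rw [integral_map measurable_fst.aemeasurable f.continuous.aestronglyMeasurable]
    simpa [dualValue] using hγ' (f.toContinuousMap, 0)
  · have := Measure.isProbabilityMeasure_map (μ := (γ : Measure (X × Y)))
      (measurable_snd (α := X) (β := Y)).aemeasurable
    refine ext_of_forall_integral_eq_of_IsFiniteMeasure fun f => ?_
    rw [integral_map measurable_snd.aemeasurable f.continuous.aestronglyMeasurable]
    simpa [dualValue] using hγ' (0, f.toContinuousMap)
  · have := hP (-c) x y
    simp only [ContinuousMap.neg_apply] at this
    simp only [Prod.smul_fst, Prod.smul_snd, ContinuousMap.smul_apply, smul_eq_mul]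
    linarith
  · rw [map_neg] at hΛc
    rw [dualValue_smul, planCost, hγ]
    linarith

end Metric

end OptimalTransport

theorem mainTheorem1 {X Y : Type*}
    [MetricSpace X] [CompactSpace X] [MeasurableSpace X] [BorelSpace X]
    [MetricSpace Y] [CompactSpace Y] [MeasurableSpace Y] [BorelSpace Y]
    (c : X × Y → ℝ) (hc : Continuous c) (hc0 : ∀ p, 0 ≤ c p)
    (μ : ProbabilityMeasure X) (ν : ProbabilityMeasure Y) :
    -- the infimum defining `T_c(μ, ν)` is a minimum
    IsLeast (OptimalTransport.planCost c '' OptimalTransport.plans μ ν)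
      (OptimalTransport.transportCost c μ ν) ∧
    -- the duality formula: `T_c(μ, ν)` is the supremum of the dual problem
    IsLUB (OptimalTransport.dualValue μ ν '' OptimalTransport.admissiblePairs c)
      (OptimalTransport.transportCost c μ ν) ∧
    -- a conjugate pair attains the supremum and satisfies the extremality relation
    ∃ p : C(X, ℝ) × C(Y, ℝ), OptimalTransport.IsConjugatePair c p ∧
      OptimalTransport.dualValue μ ν p =
        sSup (OptimalTransport.dualValue μ ν '' OptimalTransport.admissiblePairs c) ∧
      ∀ γ : ProbabilityMeasure (X × Y), OptimalTransport.IsOptimalPlan c μ ν γ →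
        ∀ᵐ z ∂(γ : Measure (X × Y)), p.1 z.1 + p.2 z.2 = c z := by
  obtain ⟨γ, hγ, q, hq, hle⟩ := OptimalTransport.exists_plan_planCost_le μ ν ⟨c, hc⟩
  obtain ⟨p, hp, hmax⟩ :=
    OptimalTransport.exists_isConjugatePair_forall_dualValue_le μ ν ⟨c, hc⟩
  have hweak : ∀ γ' ∈ OptimalTransport.plans μ ν,
      OptimalTransport.dualValue μ ν p ≤ OptimalTransport.planCost c γ' := fun γ' hγ' =>
    OptimalTransport.dualValue_le_planCost ⟨c, hc⟩ hγ' hp.1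
  have heq : OptimalTransport.planCost c γ = OptimalTransport.dualValue μ ν p :=
    (hle.trans (hmax q hq)).antisymm (hweak γ hγ)
  have hleast : IsLeast (OptimalTransport.planCost c '' OptimalTransport.plans μ ν)
      (OptimalTransport.dualValue μ ν p) :=
    ⟨⟨γ, hγ, heq⟩, by rintro _ ⟨γ', hγ', rfl⟩; exact hweak γ' hγ'⟩
  have hgreatest : IsGreatest
      (OptimalTransport.dualValue μ ν '' OptimalTransport.admissiblePairs c)
      (OptimalTransport.dualValue μ ν p) :=
    ⟨⟨p, hp.1, rfl⟩, by rintro _ ⟨q', hq', rfl⟩; exact hmax q' hq'⟩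
  have hT : OptimalTransport.transportCost c μ ν = OptimalTransport.dualValue μ ν p :=
    hleast.csInf_eq
  rw [hT]
  refine ⟨hleast, hgreatest.isLUB, p, hp, hgreatest.csSup_eq.symm, fun γ' hγ' => ?_⟩
  exact OptimalTransport.ae_add_eq_of_dualValue_eq ⟨c, hc⟩ hγ'.1 hp.1 (hT.symm.trans hγ'.2.symm)
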